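/- Let $\mathsf B$ be a locally presentable abelian category with a projective generator $P$, let $R$ be an associative unital ring, and let $\theta\colon R\to \mathrm{Hom}_{\mathsf B}(P,P)^{\mathrm{op}}$ be a (unital) ring homomorphism. Let $\Theta=\mathrm{Hom}_{\mathsf B}(P,-)\colon\mathsf B\to R\text{-}\mathrm{mod}$ be the resulting (exact) functor to the category of left $R$-modules, where $r\in R$ acts on $\mathrm{Hom}_{\mathsf B}(P,B)$ by precomposition with $\theta(r)$. Assume that $\Theta$ is fully faithful, and let $\Theta(\mathsf B)\subset R\text{-}\mathrm{mod}$ be its essential image. Terminology. Let $\mathsf C\subset R\text{-}\mathrm{mod}$ be a full subcategory. - $\mathsf C$ is the right $0$-perpendicular subcategory to a class of morphisms $\mathsf F$ in $R\text{-}\mathrm{mod}$ if a module $C$ belongs to $\mathsf C$ if and only if $\mathrm{Hom}_R(f,C)\colon \mathrm{Hom}_R(U'',C)\to\mathrm{Hom}_R(U',C)$ is an isomorphism for every morphism $f\colon U'\to U''$ in $\mathsf F$. - $\mathsf C$ is the right $1$-perpendicular subcategory to a class of modules $\mathsf E$ if a module $C$ belongs to $\mathsf C$ if and only if $\mathrm{Hom}_R(E,C)=0=\mathrm{Ext}^1_R(E,C)$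 for all $E\in\mathsf E$. - For an integer $n\ge 1$ (resp. $n=\infty$), $\mathsf C$ is the right $n$-perpendicular subcategory to $\mathsf E$ if it is the right $1$-perpendicular subcategory to $\mathsf E$ and, moreover, $\mathrm{Ext}^i_R(E,C)=0$ for all $E\in\mathsf E$, $C\in\mathsf C$ and all integers $0\le i\le n$ (resp. all $i\ge 0$). Then: (a) $\Theta(\mathsf B)$ is the right $0$-perpendicular subcategory to some set of morphisms in $R\text{-}\mathrm{mod}$. Suppose in addition that $\theta$ is injective. Then: (b) $\Theta(\mathsf B)$ is the right $1$-perpendicular subcategory to some set of modules if and only if it is closed under extensions in $R\text{-}\mathrm{mod}$; likewise, $\Theta(\mathsf B)$ is the right $1$-perpendicular subcategory to some class of modules if and only if it is closed under extensions. (c) Let $n\ge 1$ be an integer. If the maps $\mathrm{Ext}^i_{\mathsf B}(B,C)\to\mathrm{Ext}^i_R(\Theta(B),\Theta(C))$ induced by $\Theta$ are isomorphisms for all $B,C\in\mathsf B$ and all $0\le i\le n$, then $\Theta(\mathsf B)$ is the right $n$-perpendicular subcategory to some set of modules. (d) If the maps $\mathrm{Ext}^i_{\mathsf B}(B,C)\to\mathrm{Ext}^i_R(\Theta(B),\Theta(C))$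 induced by $\Theta$ are isomorphisms for all $B,C\in\mathsf B$ and all $i\ge 0$, then $\Theta(\mathsf B)$ is the right $\infty$-perpendicular subcategory to some set of modules. -/

import Mathlib

open CategoryTheory CategoryTheory.Limits CategoryTheory.Abelian

universe w v v' u u'

namespace RightPerp

section Perpendicular

/-- `B` is the right `0`-perpendicular subcategory `F^{⊥₀}` to the class of morphisms `F`:
an object `X` lies in `B` iff `Hom(f, X) : Hom(U'', X) → Hom(U', X)` is bijective for
every `f : U' ⟶ U''` in `F`. -/
def IsRightZeroPerpTo {A : Type u} [Category.{v} A]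
    (B : ObjectProperty A) (F : MorphismProperty A) : Prop :=
  ∀ X : A, B X ↔ ∀ ⦃U' U'' : A⦄ (f : U' ⟶ U''), F f →
    Function.Bijective (fun g : U'' ⟶ X => f ≫ g)

/-- `B` is the right `1`-perpendicular subcategory `E^{⊥₀,₁}` to the class of objects `E`:
an object `X` lies in `B` iff `Hom(Y, X) = 0 = Ext¹(Y, X)` for every `Y` in `E`. -/
def IsRightOnePerpTo {A : Type u} [Category.{v} A] [Abelian A] [HasExt.{w} A]
    (B E : ObjectProperty A) : Prop :=
  ∀ X : A, B X ↔ ∀ Y : A, E Y → Subsingleton (Y ⟶ X) ∧ Subsingleton (Ext.{w} Y X 1)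

/-- For `1 ≤ n ≤ ∞`, `B` is the right `n`-perpendicular subcategory to the class of objects `E`:
it is the right `1`-perpendicular subcategory to `E`, and `Ext^i(Y, X) = 0` for all `Y` in `E`,
all `X` in `B` and all (finite) `0 ≤ i ≤ n`. -/
def IsRightPerpTo {A : Type u} [Category.{v} A] [Abelian A] [HasExt.{w} A]
    (n : ℕ∞) (B E : ObjectProperty A) : Prop :=
  IsRightOnePerpTo.{w} B E ∧
    ∀ Y X : A, E Y → B X → ∀ i : ℕ, (i : ℕ∞) ≤ n → Subsingleton (Ext.{w} Y X i)

end Perpendicular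

/-- The exact functor `F` induces an isomorphism
`Ext^i(X, Y) → Ext^i(F X, F Y)` for all objects `X`, `Y`.
(Here `Ext` is taken in the universe in which it exists for every abelian category;
it does not depend on this choice up to a bijection.) -/
def InducesExtIso {A : Type u} [Category.{v} A] [Abelian A] {D : Type u'} [Category.{v'} D]
    [Abelian D] (F : A ⥤ D) [F.Additive] [PreservesFiniteLimits F] [PreservesFiniteColimits F]
    (i : ℕ) : Prop :=
  have : HasExt.{max u v} A := HasExt.standard A
  have : HasExt.{max u' v'} D := HasExt.standard D
  ∀ X Y : A, Function.Bijective
    (F.mapExtAddHom X Y i : Ext.{max u v} X Y i →+ Ext.{max u' v'} (F.obj X) (F.obj Y) i)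

noncomputable section Theta

variable {B : Type u} [Category.{v} B] [Abelian B] (P : B) {R : Type v} [Ring R]
  (θ : R →+* (End P)ᵐᵒᵖ)

/-- The functor `Θ = Hom(P, -) : B ⥤ R-Mod`, where `r : R` acts on `Hom(P, X)` by precomposition
with the endomorphism `θ r` of `P`. -/
def homFunctor : B ⥤ ModuleCat.{v} R :=
  preadditiveCoyonedaObj P ⋙ ModuleCat.restrictScalars θ

theorem homFunctor_smul (X : B) (r : R) (f : (homFunctor P θ).obj X) :
    (r • f : (homFunctor P θ).obj X) = ((θ r).unop : P ⟶ P) ≫ (f : P ⟶ X) := rfl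

theorem homFunctor_map {X Y : B} (g : X ⟶ Y) (f : (homFunctor P θ).obj X) :
    (homFunctor P θ).map g f = (f : P ⟶ X) ≫ g := rfl

instance : (homFunctor P θ).Additive := by
  unfold homFunctor; infer_instance

instance [Projective P] : PreservesFiniteColimits (homFunctor P θ) := by
  unfold homFunctor; infer_instance

instance : PreservesFiniteLimits (homFunctor P θ) := by
  have : PreservesFiniteLimits (preadditiveCoyonedaObj P) := PreservesLimits.preservesFiniteLimits _
  have : PreservesFiniteLimits (ModuleCat.restrictScalars.{v} θ) :=
    ⟨fun _ _ _ => ⟨fun {_} => inferInstance⟩⟩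
  exact comp_preservesFiniteLimits _ _

end Theta

end RightPerp

/-! Write `Θ` for `homFunctor P θ`. Its essential image consists of the modules `M` for which every
family `X → M` extends uniquely along the unit `R^(X) → Hom(P, P^(X))`; a module with this property
for all nonempty `X` is `Θ` of the cokernel of a map of copowers
(`essImage_of_hasUniqueExtensions`). As `P` is presentable, each map `P → P^(X)` factors through
`P^(K)` for one fixed infinite `K`, so testing `X = K` suffices
(`HasUniqueExtensions.of_factorization`). This is (a), with the unit on `K` as the only morphism.

If `θ` is injective, that unit is mono with cokernel `E`, and `{E}` serves in (b), (c) and (d).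
Vanishing of `Hom(E, M)` and `Ext¹(E, M)` gives unique extension; the converse needs `Ext¹(Θ(P^(K)),
M) = 0` for `M` in the image. Closure under extensions ensures this by splitting extensions over the
projective `P^(K)`, and so does an isomorphism on `Ext¹`. Higher vanishing for `E` is dimension
shifting, since `R^(K)` is projective. -/

namespace RightPerp

open Opposite

/-! ### Copowers of a presentable object -/

section Copower

variable {B : Type u} [Category.{v} B] [HasCoproducts.{v} B] (P : B)

/-- The coproduct of copies of `P` indexed by a type, as a functor of that type. -/
noncomputable abbrev copower : Type v ⥤ B := sigmaConst.obj P

/-- The inclusion of a summand in a copower of `P`. -/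
noncomputable abbrev copowerι {X : Type v} (x : X) : P ⟶ (copower P).obj X :=
  Sigma.ι (fun _ : X => P) x

variable {P} in
lemma copower_hom_ext {X : Type v} {Y : B} {f g : (copower P).obj X ⟶ Y}
    (h : ∀ x, copowerι P x ≫ f = copowerι P x ≫ g) : f = g :=
  Sigma.hom_ext _ _ h

lemma copowerι_map {X Y : Type v} (φ : X ⟶ Y) (x : X) :
    copowerι P x ≫ (copower P).map φ = copowerι P (φ x) := by
  simp

/-- Morphisms from a presentable object to its copowers factor through copowers of bounded size. -/
lemma exists_factorization_copower [IsPresentable.{v} P] :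
    ∃ K : Type v, Infinite K ∧ ∀ (X : Type v) [Nonempty X] (t : P ⟶ (copower P).obj X),
      ∃ (φ : K ⟶ X) (s : P ⟶ (copower P).obj K), s ≫ (copower P).map φ = t := by
  obtain ⟨κ, hκ, _⟩ := Functor.IsAccessible.exists_cardinal.{v} (F := coyoneda.obj (op P))
  have h0 : Cardinal.aleph0 ≤ κ := Cardinal.IsRegular.aleph0_le Fact.out
  obtain ⟨K, hK⟩ : ∃ K : Type v, Cardinal.mk K = κ := ⟨_, Cardinal.mk_out κ⟩
  refine ⟨K, by rwa [Cardinal.infinite_iff, hK], fun X _ t => ?_⟩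
  have : IsCardinalPresentable P κ := ‹_›
  have : (copower P).IsLeftAdjoint := (sigmaConstAdj P).isLeftAdjoint
  obtain ⟨A, f, hf⟩ := IsCardinalPresentable.exists_hom_of_isColimit κ
    (isColimitOfPreserves (copower P) (HasCardinalLT.Set.isColimitCocone X κ h0)) t
  obtain ⟨i⟩ : Cardinal.mk A.1 ≤ Cardinal.mk K := by
    rw [hK]
    exact ((hasCardinalLT_iff_cardinal_mk_lt _ _).1 A.2).le
  let a : (A.1 : Type v) ⟶ K := ↾ i
  -- Outside the image of `A` the value is arbitrary; this is where `X` must be nonempty.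
  let φ : K ⟶ X := ↾ (Function.extend i Subtype.val fun _ => Classical.arbitrary X)
  have ha : a ≫ φ = (HasCardinalLT.Set.cocone X κ).ι.app A := by
    ext y
    exact i.injective.extend_apply Subtype.val (fun _ => Classical.arbitrary X) y
  refine ⟨φ, f ≫ (copower P).map a, ?_⟩
  rw [Category.assoc]
  exact (congrArg (f ≫ ·) (((copower P).map_comp a φ).symm.trans (congrArg _ ha))).trans hf

end Copower

/-! ### Free objects and unique extensions -/

section FreeObjects

variable {B : Type u} [Category.{v} B] [Abelian B] [HasCoproducts.{v} B] (P : B)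
  {R : Type v} [Ring R] (θ : R →+* (End P)ᵐᵒᵖ)

/-- The functor of free objects of `Θ(B)`: it sends a type `X` to `Hom(P, P^(X))`. -/
noncomputable def freeObj : Type v ⥤ ModuleCat.{v} R := copower P ⋙ homFunctor P θ

/-- The generators of the free objects of `Θ(B)`. -/
noncomputable def freeGen {X : Type v} (x : X) : (freeObj P θ).obj X := copowerι P x

lemma freeObj_map_freeGen {X Y : Type v} (φ : X ⟶ Y) (x : X) :
    (freeObj P θ).map φ (freeGen P θ x) = freeGen P θ (φ x) :=
  copowerι_map P φ x

/-- Every family of elements of `M` indexed by `X` extends uniquely to a morphism from the free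
object of `Θ(B)` on `X`. -/
def HasUniqueExtensions (X : Type v) (M : ModuleCat.{v} R) : Prop :=
  Function.Bijective fun (g : (freeObj P θ).obj X ⟶ M) (x : X) => g (freeGen P θ x)

variable {P θ}

lemma HasUniqueExtensions.hom_ext {X : Type v} {M : ModuleCat.{v} R}
    (h : HasUniqueExtensions P θ X M) {f g : (freeObj P θ).obj X ⟶ M}
    (hfg : ∀ x, f (freeGen P θ x) = g (freeGen P θ x)) : f = g :=
  h.1 (funext hfg)

lemma HasUniqueExtensions.exists_extension {X : Type v} {M : ModuleCat.{v} R}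
    (h : HasUniqueExtensions P θ X M) (m : X → M) :
    ∃ g : (freeObj P θ).obj X ⟶ M, ∀ x, g (freeGen P θ x) = m x :=
  (h.2 m).imp fun _ hg => congrFun hg

lemma hasUniqueExtensions_homFunctor_obj [(homFunctor P θ).Full] [(homFunctor P θ).Faithful]
    (X : Type v) (A : B) : HasUniqueExtensions P θ X ((homFunctor P θ).obj A) := by
  refine ⟨fun g g' h => ?_, fun m => ?_⟩
  · obtain ⟨f, rfl⟩ := (homFunctor P θ).map_surjective g
    obtain ⟨f', rfl⟩ := (homFunctor P θ).map_surjective g'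
    exact congrArg _ (copower_hom_ext fun x => congrFun h x)
  · refine ⟨(homFunctor P θ).map (Sigma.desc fun x => (m x : P ⟶ A)), funext fun x => ?_⟩
    exact Sigma.ι_desc (fun x => (m x : P ⟶ A)) x

lemma HasUniqueExtensions.of_iso {X : Type v} {M N : ModuleCat.{v} R}
    (h : HasUniqueExtensions P θ X M) (e : M ≅ N) : HasUniqueExtensions P θ X N := by
  refine ⟨fun g g' hg => ?_, fun m => ?_⟩
  · rw [← cancel_mono e.inv]
    exact h.hom_ext fun x => congrArg e.inv (congrFun hg x)
  · obtain ⟨g, hg⟩ := h.exists_extension fun x => e.inv (m x)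
    refine ⟨g ≫ e.hom, funext fun x => ?_⟩
    simp [hg]

lemma hasUniqueExtensions_of_essImage [(homFunctor P θ).Full] [(homFunctor P θ).Faithful]
    (X : Type v) {M : ModuleCat.{v} R} (hM : (homFunctor P θ).essImage M) :
    HasUniqueExtensions P θ X M :=
  (hasUniqueExtensions_homFunctor_obj X hM.witness).of_iso hM.getIso

/-- Unique extensions along a type `K` through which all elements of the free objects factor
give unique extensions along all nonempty types. -/
lemma HasUniqueExtensions.of_factorization {K : Type v} [Infinite K] {M : ModuleCat.{v} R}
    (hK : ∀ (X : Type v) [Nonempty X] (t : (freeObj P θ).obj X),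
      ∃ (φ : K ⟶ X) (s : (freeObj P θ).obj K), (freeObj P θ).map φ s = t)
    (h : HasUniqueExtensions P θ K M) (X : Type v) [Nonempty X] :
    HasUniqueExtensions P θ X M := by
  refine ⟨fun g g' hg => ?_, fun m => ?_⟩
  · ext t
    obtain ⟨φ, s, rfl⟩ := hK X t
    have : (freeObj P θ).map φ ≫ g = (freeObj P θ).map φ ≫ g' := h.hom_ext fun k => by
      simpa only [ModuleCat.comp_apply, freeObj_map_freeGen] using congrFun hg (φ k)
    exact ConcreteCategory.congr_hom this s
  -- Since `K ⊕ K ≃ K`, the `K`-indexed supports in `X` are directed.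
  have hsup : ∀ φ ψ : K → X, ∃ χ : K → X, Set.range φ ⊆ Set.range χ ∧
      Set.range ψ ⊆ Set.range χ := fun φ ψ => by
    have hc : Cardinal.mk (K ⊕ K) = Cardinal.mk K := by
      simp
    obtain ⟨e⟩ := Cardinal.eq.1 hc
    refine ⟨Sum.elim φ ψ ∘ e.symm, ?_, ?_⟩ <;> rw [e.symm.surjective.range_comp]
    · rintro _ ⟨k, rfl⟩; exact ⟨Sum.inl k, rfl⟩
    · rintro _ ⟨k, rfl⟩; exact ⟨Sum.inr k, rfl⟩
  have key : ∀ φ : K → X, ∃ G : (freeObj P θ).obj X ⟶ M, ∀ x ∈ Set.range φ,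
      G (freeGen P θ x) = m x := fun φ => by
    obtain ⟨g, hg⟩ := h.exists_extension (m ∘ φ)
    -- `Function.invFun φ` is a section of `φ` over its range, so the composite takes the prescribed
    -- values there.
    refine ⟨(freeObj P θ).map (↾ (Function.invFun φ)) ≫ g, fun x hx => ?_⟩
    rw [ModuleCat.comp_apply, freeObj_map_freeGen]
    exact (hg _).trans (congrArg m (Function.invFun_eq hx))
  choose G hG using key
  have agree : ∀ (φ ψ : K → X) (s : (freeObj P θ).obj K), Set.range φ ⊆ Set.range ψ →
      G φ ((freeObj P θ).map (↾ φ) s) = G ψ ((freeObj P θ).map (↾ φ) s) := fun φ ψ s hφ => by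
    have : (freeObj P θ).map (↾ φ) ≫ G φ = (freeObj P θ).map (↾ φ) ≫ G ψ :=
      h.hom_ext fun k => by
        simp only [ModuleCat.comp_apply, freeObj_map_freeGen]
        exact (hG φ _ ⟨k, rfl⟩).trans (hG ψ _ (hφ ⟨k, rfl⟩)).symm
    exact ConcreteCategory.congr_hom this s
  choose φ s hs using hK X
  have agree' : ∀ (t : (freeObj P θ).obj X) (ψ : K → X), Set.range (φ t) ⊆ Set.range ψ →
      G (φ t) t = G ψ t := fun t ψ ht => by
    have := agree (φ t) ψ (s t) ht
    erw [hs t] at this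
    exact this
  -- Evaluate each `t` through a support `φ t`. By `agree'` any larger support gives the same value,
  -- so linearity can be checked on a common one.
  let ℓ : (freeObj P θ).obj X →ₗ[R] M :=
    { toFun := fun t => G (φ t) t
      map_add' := fun t t' => by
        obtain ⟨χ, h1, h2⟩ := hsup (φ t) (φ t')
        obtain ⟨ω, h3, h4⟩ := hsup χ (φ (t + t'))
        rw [agree' t ω (h1.trans h3), agree' t' ω (h2.trans h3), agree' _ ω h4, map_add]
      map_smul' := fun r t => by
        obtain ⟨χ, h1, h2⟩ := hsup (φ t) (φ (r • t))
        rw [agree' t χ h1, agree' _ χ h2]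
        exact map_smul (G χ).hom r t }
  refine ⟨(ModuleCat.ofHom ℓ :), funext fun x => ?_⟩
  obtain ⟨χ, h1, h2⟩ := hsup (φ (freeGen P θ x)) (fun _ => x)
  refine (agree' _ χ h1).trans (hG χ x (h2 ?_))
  exact ⟨Classical.arbitrary K, rfl⟩

/-- The free `R`-module on a type, mapped to the free object of `Θ(B)`. -/
noncomputable def freeUnit (P : B) (θ : R →+* (End P)ᵐᵒᵖ) (X : Type v) :
    ModuleCat.of R (X →₀ R) ⟶ (freeObj P θ).obj X :=
  let ℓ : (X →₀ R) →ₗ[R] (freeObj P θ).obj X := Finsupp.linearCombination R (freeGen P θ)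
  (ModuleCat.ofHom ℓ :)

lemma freeUnit_single (X : Type v) (x : X) :
    freeUnit P θ X (Finsupp.single x 1) = freeGen P θ x :=
  (Finsupp.linearCombination_single R 1 x).trans (one_smul R _)

lemma hasUniqueExtensions_iff (X : Type v) (M : ModuleCat.{v} R) :
    HasUniqueExtensions P θ X M ↔
      Function.Bijective fun g : (freeObj P θ).obj X ⟶ M => freeUnit P θ X ≫ g := by
  have hev : Function.Bijective fun (g : ModuleCat.of R (X →₀ R) ⟶ M) (x : X) =>
      g (Finsupp.single x 1) := by
    refine ⟨fun g g' hg => ?_, fun m => ?_⟩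
    · ext x
      exact congrFun hg x
    · refine ⟨ModuleCat.ofHom (Finsupp.linearCombination R m), funext fun x => ?_⟩
      exact (Finsupp.linearCombination_single R 1 x).trans (one_smul R _)
  rw [← hev.of_comp_iff']
  refine iff_of_eq (congrArg Function.Bijective ?_)
  funext g x
  exact congrArg g (freeUnit_single X x).symm

end FreeObjects

lemma exists_comp_eq_of_ker_le {R M N L : Type*} [Ring R] [AddCommGroup M] [AddCommGroup N]
    [AddCommGroup L] [Module R M] [Module R N] [Module R L] (p : M →ₗ[R] N)
    (hp : Function.Surjective p) (f : M →ₗ[R] L) (hf : LinearMap.ker p ≤ LinearMap.ker f) :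
    ∃ g : N →ₗ[R] L, ∀ x, g (p x) = f x := by
  refine ⟨(LinearMap.ker p).liftQ f hf ∘ₗ (p.quotKerEquivOfSurjective hp).symm.toLinearMap,
    fun x => ?_⟩
  have : (p.quotKerEquivOfSurjective hp).symm (p x) = Submodule.Quotient.mk x := by
    rw [LinearEquiv.symm_apply_eq]
    rfl
  simp [this]

/-! ### Recognising the essential image -/

section EssImage

variable {B : Type u} [Category.{v} B] [Abelian B] {P : B}
  {R : Type v} [Ring R] {θ : R →+* (End P)ᵐᵒᵖ}

lemma homFunctor_map_eq_zero [Projective P] {X Y : B} (d : X ⟶ Y)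
    (t : (homFunctor P θ).obj Y) (ht : (homFunctor P θ).map (cokernel.π d) t = 0) :
    ∃ s, (homFunctor P θ).map d s = t := by
  have hS : (ShortComplex.mk d (cokernel.π d) (by simp)).Exact :=
    ShortComplex.exact_of_g_is_cokernel _ (cokernelIsCokernel d)
  exact ⟨hS.liftFromProjective (t : P ⟶ Y) ht, hS.liftFromProjective_comp (t : P ⟶ Y) ht⟩

lemma homFunctor_map_surjective [Projective P] {X Y : B} (p : X ⟶ Y) [Epi p] :
    Function.Surjective ((homFunctor P θ).map p) := fun t =>
  ⟨Projective.factorThru (t : P ⟶ Y) p, Projective.factorThru_comp (t : P ⟶ Y) p⟩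

variable [HasCoproducts.{v} B]

lemma exists_map_freeGen {X Y : Type v} (z : X → (freeObj P θ).obj Y) :
    ∃ d : (copower P).obj X ⟶ (copower P).obj Y,
      ∀ x, (homFunctor P θ).map d (freeGen P θ x) = z x :=
  ⟨Sigma.desc fun x => (z x : P ⟶ (copower P).obj Y),
    fun x => Sigma.ι_desc (fun x => (z x : P ⟶ (copower P).obj Y)) x⟩

/-- Extend the identity of `M` to `q` on the free object, and let `d` be the map of copowers given
by the relations in `R^(M) → M`. Uniqueness makes `q` kill `Θ(d)`, and `q` identifies `M` with
`Θ(coker d)`. -/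
lemma essImage_of_hasUniqueExtensions [Projective P] [(homFunctor P θ).Full]
    [(homFunctor P θ).Faithful] {M : ModuleCat.{v} R}
    (h : ∀ (X : Type v) [Nonempty X], HasUniqueExtensions P θ X M) :
    (homFunctor P θ).essImage M := by
  obtain ⟨q, hq⟩ := (h M).exists_extension id
  let p : (M →₀ R) →ₗ[R] M := Finsupp.linearCombination R id
  have hp : ∀ z, q (freeUnit P θ M z) = p z := by
    have : freeUnit P θ M ≫ q = ModuleCat.ofHom p := by
      ext m
      simp only [p]
      exact (congrArg q (freeUnit_single (M : Type v) m)).trans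
        ((hq m).trans (by simp))
    exact fun z => ConcreteCategory.congr_hom this z
  obtain ⟨d, hd⟩ := exists_map_freeGen (P := P) (θ := θ)
    fun z : LinearMap.ker p => freeUnit P θ M z.1
  have hdq : (homFunctor P θ).map d ≫ q = 0 :=
    (h (LinearMap.ker p)).hom_ext fun z =>
      (congrArg q (hd z)).trans ((hp z.1).trans z.2)
  let π := (homFunctor P θ).map (cokernel.π d)
  have hdπ : ∀ s, π ((homFunctor P θ).map d s) = 0 := fun s => by
    have : (homFunctor P θ).map d ≫ π = 0 := by
      rw [← Functor.map_comp, cokernel.condition, Functor.map_zero]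
    exact ConcreteCategory.congr_hom this s
  have hpsurj : Function.Surjective p := fun m => ⟨Finsupp.single m 1, by simp [p]⟩
  obtain ⟨j, hj⟩ := exists_comp_eq_of_ker_le p hpsurj (freeUnit P θ M ≫ π).hom fun z hz => by
    exact (congrArg π (hd ⟨z, hz⟩)).symm.trans (hdπ _)
  have hjq : q ≫ ModuleCat.ofHom j = π :=
    (hasUniqueExtensions_homFunctor_obj (M : Type v) (cokernel d)).hom_ext fun m => by
      have h1 := hj (Finsupp.single m 1)
      have h2 : p (Finsupp.single m 1) = m := by simp [p]
      rw [h2] at h1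
      exact (congrArg j (hq m)).trans (h1.trans (congrArg π (freeUnit_single _ m)))
  have hjq' : ∀ t, j (q t) = π t := fun t => ConcreteCategory.congr_hom hjq t
  have hbij : Function.Bijective j := by
    constructor
    · rw [← LinearMap.ker_eq_bot, LinearMap.ker_eq_bot']
      intro m hm
      -- If `j m = 0`, the generator at `m` lies in the image of `Θ(d)`, which `q` kills, while `q`
      -- sends it to `m`.
      obtain ⟨s, hs⟩ := homFunctor_map_eq_zero d (freeGen P θ m) <| by
        rw [← hm]
        exact (hjq' _).symm.trans (congrArg j (hq m))
      exact (hq m).symm.trans ((congrArg q hs.symm).trans (ConcreteCategory.congr_hom hdq s))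
    · intro c
      obtain ⟨t, ht⟩ := homFunctor_map_surjective (cokernel.π d) c
      exact ⟨q t, (hjq' t).trans ht⟩
  exact ⟨cokernel d, ⟨(LinearEquiv.ofBijective j hbij).toModuleIso.symm⟩⟩

/-- The essential image of `Θ` consists of the modules with unique extensions along a
single sufficiently large free object. -/
lemma exists_essImage_iff_hasUniqueExtensions [Projective P] [IsPresentable.{v} P]
    [(homFunctor P θ).Full] [(homFunctor P θ).Faithful] :
    ∃ K : Type v, ∀ M : ModuleCat.{v} R,
      (homFunctor P θ).essImage M ↔ HasUniqueExtensions P θ K M := by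
  obtain ⟨K, _, hK⟩ := exists_factorization_copower P
  exact ⟨K, fun M => ⟨hasUniqueExtensions_of_essImage K, fun h =>
    essImage_of_hasUniqueExtensions (h.of_factorization hK)⟩⟩

end EssImage

/-- The pushout of a short exact sequence along a morphism out of its first term. -/
lemma shortExact_pushout {A : Type u} [Category.{v} A] [Abelian A] {S : ShortComplex A}
    (hS : S.ShortExact) {M : A} (φ : S.X₁ ⟶ M) :
    (ShortComplex.mk (pushout.inr S.f φ) (pushout.desc S.g (0 : M ⟶ S.X₃) (by simp))
      (pushout.inr_desc _ _ _)).ShortExact := by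
  have := hS.mono_f
  have := hS.epi_g
  have hepi : Epi (pushout.desc S.g (0 : M ⟶ S.X₃) (by simp) : pushout S.f φ ⟶ S.X₃) :=
    epi_of_epi_fac (pushout.inl_desc S.g (0 : M ⟶ S.X₃) (by simp))
  refine ShortComplex.ShortExact.mk' (ShortComplex.exact_of_g_is_cokernel _ ?_)
    (inferInstanceAs (Mono (pushout.inr S.f φ))) hepi
  refine CokernelCofork.IsColimit.ofπ' _ _ fun {Z} k hk => ?_
  have hk' : S.f ≫ pushout.inl S.f φ ≫ k = 0 := by
    rw [pushout.condition_assoc]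
    dsimp at hk
    rw [hk, comp_zero]
  refine ⟨hS.exact.desc _ hk', ?_⟩
  dsimp at hk ⊢
  apply pushout.hom_ext
  · rw [pushout.inl_desc_assoc, hS.exact.g_desc]
  · rw [pushout.inr_desc_assoc, zero_comp, hk]

/-! ### Vanishing of Ext along short exact sequences -/

section Ext

variable {A : Type u} [Category.{v} A] [Abelian A] [HasExt.{w} A]

lemma subsingleton_ext_zero_iff (X Y : A) :
    Subsingleton (Ext.{w} X Y 0) ↔ Subsingleton (X ⟶ Y) :=
  Ext.homEquiv₀.subsingleton_congr

lemma subsingleton_ext_of_covariant {S : ShortComplex A} (hS : S.ShortExact) (X : A) (n : ℕ)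
    (h₁ : Subsingleton (Ext.{w} X S.X₁ n)) (h₃ : Subsingleton (Ext.{w} X S.X₃ n)) :
    Subsingleton (Ext.{w} X S.X₂ n) :=
  subsingleton_of_forall_eq 0 fun x => by
    obtain ⟨y, rfl⟩ := Ext.covariant_sequence_exact₂ X hS x (Subsingleton.elim _ _)
    rw [Subsingleton.elim y 0, Ext.zero_comp]

lemma subsingleton_ext_of_contravariant {S : ShortComplex A} (hS : S.ShortExact) (Y : A) (n : ℕ)
    (h₁ : Subsingleton (Ext.{w} S.X₁ Y n)) (h₂ : Subsingleton (Ext.{w} S.X₂ Y (1 + n))) :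
    Subsingleton (Ext.{w} S.X₃ Y (1 + n)) :=
  subsingleton_of_forall_eq 0 fun x => by
    obtain ⟨y, rfl⟩ := Ext.contravariant_sequence_exact₃ hS Y x (Subsingleton.elim _ _) rfl
    rw [Subsingleton.elim y 0, Ext.comp_zero]

lemma bijective_comp_of_subsingleton_ext {S : ShortComplex A} (hS : S.ShortExact) (Y : A)
    (h₀ : Subsingleton (S.X₃ ⟶ Y)) (h₁ : Subsingleton (Ext.{w} S.X₃ Y 1)) :
    Function.Bijective fun g : S.X₂ ⟶ Y => S.f ≫ g := by
  have := hS.mono_f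
  have := hS.epi_g
  refine ⟨fun g g' hg => ?_, fun y => ?_⟩
  · have h : S.f ≫ (g - g') = 0 := by
      rw [Preadditive.comp_sub]; exact sub_eq_zero.2 hg
    rw [← sub_eq_zero, ← hS.exact.g_desc _ h, Subsingleton.elim (hS.exact.desc _ h) 0, comp_zero]
  · obtain ⟨x, hx⟩ := Ext.contravariant_sequence_exact₁ hS Y (Ext.mk₀ y) rfl
      (Subsingleton.elim _ _)
    obtain ⟨g, rfl⟩ := (Ext.mk₀_bijective _ _).2 x
    refine ⟨g, (Ext.mk₀_bijective _ _).1 ?_⟩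
    rwa [Ext.mk₀_comp_mk₀] at hx

lemma subsingleton_ext_of_bijective_comp {S : ShortComplex A} (hS : S.ShortExact) (Y : A)
    (h : Function.Bijective fun g : S.X₂ ⟶ Y => S.f ≫ g)
    (h₁ : Subsingleton (Ext.{w} S.X₂ Y 1)) :
    Subsingleton (S.X₃ ⟶ Y) ∧ Subsingleton (Ext.{w} S.X₃ Y 1) := by
  have := hS.epi_g
  refine ⟨subsingleton_of_forall_eq 0 fun k => ?_, subsingleton_of_forall_eq 0 fun x => ?_⟩
  · rw [← cancel_epi S.g]
    exact h.1 (by simp)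
  · obtain ⟨y, rfl⟩ := Ext.contravariant_sequence_exact₃ hS Y x (Subsingleton.elim _ _) 
      (n₀ := 0) (add_zero 1)
    obtain ⟨y, rfl⟩ := (Ext.mk₀_bijective _ _).2 y
    obtain ⟨g, rfl⟩ := h.2 y
    rw [← Ext.mk₀_comp_mk₀]
    exact hS.extClass_comp_assoc _

/-- Right `1`-perpendicular subcategories are closed under extensions. -/
lemma IsRightOnePerpTo.isClosedUnderExtensions {C E : ObjectProperty A}
    (h : IsRightOnePerpTo.{w} C E) : C.IsClosedUnderExtensions where
  prop_X₂_of_shortExact hS h₁ h₃ := (h _).2 fun Y hY => by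
    obtain ⟨a₁, b₁⟩ := (h _).1 h₁ Y hY
    obtain ⟨a₃, b₃⟩ := (h _).1 h₃ Y hY
    rw [← subsingleton_ext_zero_iff.{w}] at a₁ a₃ ⊢
    exact ⟨subsingleton_ext_of_covariant hS Y 0 a₁ a₃, subsingleton_ext_of_covariant hS Y 1 b₁ b₃⟩

/-- If every extension of `Z` by `M` splits, then `Ext¹(Z, M) = 0`. -/
lemma subsingleton_ext_one_of_section [EnoughProjectives A] {Z M : A}
    (h : ∀ (Q : A) (i : M ⟶ Q) (p : Q ⟶ Z) (w : i ≫ p = 0),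
      (ShortComplex.mk i p w).ShortExact → ∃ s : Z ⟶ Q, s ≫ p = 𝟙 Z) :
    Subsingleton (Ext.{w} Z M 1) := by
  let S := ShortComplex.mk (kernel.ι (Projective.π Z)) (Projective.π Z) (by simp)
  have hS : S.ShortExact := ShortComplex.ShortExact.mk'
    (ShortComplex.exact_of_f_is_kernel _ (kernelIsKernel _))
    (inferInstanceAs (Mono (kernel.ι (Projective.π Z))))
    (inferInstanceAs (Epi (Projective.π Z)))
  refine subsingleton_of_forall_eq 0 fun x => ?_
  have : Projective S.X₂ := inferInstanceAs (Projective (Projective.over Z))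
  obtain ⟨y, rfl⟩ := Ext.contravariant_sequence_exact₃ hS M x
    (Ext.eq_zero_of_projective (n := 0) _) (n₀ := 0) (add_zero 1)
  obtain ⟨φ, rfl⟩ := (Ext.mk₀_bijective _ _).2 y
  have hT := shortExact_pushout hS φ
  obtain ⟨s, hs⟩ := h _ _ _ _ hT
  have hr := (ShortComplex.Splitting.ofExactOfSection _ hT.exact s hs hT.mono_f).f_r
  generalize (ShortComplex.Splitting.ofExactOfSection _ hT.exact s hs hT.mono_f).r = r at hr
  dsimp at r hr
  -- A retraction of the pushout extension extends `φ` over the projective cover term, so its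
  -- connecting class vanishes.
  have hφ : φ = S.f ≫ pushout.inl S.f φ ≫ r := by
    rw [pushout.condition_assoc, hr, Category.comp_id]
  rw [hφ, ← Ext.mk₀_comp_mk₀]
  exact hS.extClass_comp_assoc _

end Ext

lemma subsingleton_ext_obj_of_induces {A : Type u} [Category.{v} A] [Abelian A] {D : Type u'}
    [Category.{v'} D] [Abelian D] [HasExt.{w} D] (F : A ⥤ D) [F.Additive]
    [PreservesFiniteLimits F] [PreservesFiniteColimits F] {i : ℕ} (h : InducesExtIso F (i + 1))
    (X Y : A) [Projective X] : Subsingleton (Ext.{w} (F.obj X) (F.obj Y) (i + 1)) := by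
  have : HasExt.{max u v} A := HasExt.standard A
  have : HasExt.{max u' v'} D := HasExt.standard D
  have := Ext.subsingleton_of_projective.{max u v} X Y i
  have := (h X Y).2.subsingleton
  exact Ext.chgUniv.{w, max u' v'}.symm.subsingleton

/-! ### The perpendicular module -/

section Perpendicular

variable {B : Type u} [Category.{v} B] [Abelian B] {P : B}
  {R : Type v} [Ring R] {θ : R →+* (End P)ᵐᵒᵖ}

/-- The middle term of an extension is again in the image, so by fullness its projection comes from
an epimorphism onto the projective `Z`, which splits. -/
lemma subsingleton_ext_one_homFunctor_obj [Projective P] [(homFunctor P θ).Full]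
    [(homFunctor P θ).Faithful] (hC : (homFunctor P θ).essImage.IsClosedUnderExtensions)
    (Z : B) [Projective Z] (M : ModuleCat.{v} R) (hM : (homFunctor P θ).essImage M) :
    Subsingleton (Ext.{v} ((homFunctor P θ).obj Z) M 1) := by
  refine subsingleton_ext_one_of_section fun Q i p w hS => ?_
  obtain ⟨D, ⟨e⟩⟩ : (homFunctor P θ).essImage Q :=
    hC.prop_X₂_of_shortExact hS hM ((homFunctor P θ).obj_mem_essImage _)
  obtain ⟨p₀, hp₀⟩ := (homFunctor P θ).map_surjective (e.hom ≫ p)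
  have : Epi p := hS.epi_g
  have hepi : Epi p₀ := (homFunctor P θ).epi_of_epi_map <| by
    rw [hp₀]
    exact epi_comp e.hom p
  refine ⟨(homFunctor P θ).map (Projective.factorThru (𝟙 Z) p₀) ≫ e.hom, ?_⟩
  rw [Category.assoc, ← hp₀, ← Functor.map_comp, Projective.factorThru_comp,
    CategoryTheory.Functor.map_id]

variable [HasCoproducts.{v} B]

lemma freeUnit_injective (hθ : Function.Injective θ) (X : Type v) :
    Function.Injective (freeUnit P θ X) := by
  classical
  refine (injective_iff_map_eq_zero (freeUnit P θ X).hom).2 fun z hz => Finsupp.ext fun x => ?_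
  -- Projection to the summand `x` turns the unit into `z ↦ θ (z x)`, so injectivity of `θ` recovers
  -- each coordinate.
  let pr : (copower P).obj X ⟶ P := Sigma.desc fun y => if y = x then 𝟙 P else 0
  let one : (homFunctor P θ).obj P := 𝟙 P
  let f : (X →₀ R) →ₗ[R] (homFunctor P θ).obj P :=
    (freeUnit P θ X ≫ (homFunctor P θ).map pr).hom
  let g : (X →₀ R) →ₗ[R] (homFunctor P θ).obj P :=
    (LinearMap.toSpanSingleton R _ one) ∘ₗ Finsupp.lapply x
  have hfg : f = g := Finsupp.lhom_ext' fun y => LinearMap.ext_ring <| by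
    have h1 : f (Finsupp.single y 1) = (if y = x then 𝟙 P else 0 : P ⟶ P) :=
      (congrArg ((homFunctor P θ).map pr) (freeUnit_single X y)).trans
        (Sigma.ι_desc (fun y => (if y = x then 𝟙 P else 0 : P ⟶ P)) y)
    have h2 : g (Finsupp.single y 1) = (Finsupp.single y (1 : R) x) • one := rfl
    refine h1.trans (Eq.trans ?_ h2.symm)
    by_cases hyx : y = x
    · subst hyx
      rw [if_pos rfl, Finsupp.single_eq_same, one_smul]
    · rw [if_neg hyx, Finsupp.single_eq_of_ne (Ne.symm hyx), zero_smul]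
      rfl
  have h0 : z x • one = 0 := by
    have : f z = 0 := (congrArg ((homFunctor P θ).map pr) hz).trans (map_zero _)
    rwa [hfg] at this
  have h1 : ((θ (z x)).unop : P ⟶ P) = 0 := (Category.comp_id _).symm.trans h0
  exact hθ ((MulOpposite.unop_injective h1).trans (map_zero θ).symm)

instance [Projective P] (X : Type v) : Projective ((copower P).obj X) :=
  inferInstanceAs (Projective (∐ fun _ : X => P))

/-- The short exact sequence of the unit of a free object. -/
noncomputable abbrev freeUnitComplex (P : B) (θ : R →+* (End P)ᵐᵒᵖ) (X : Type v) :
    ShortComplex (ModuleCat.{v} R) :=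
  ShortComplex.mk (freeUnit P θ X) (cokernel.π (freeUnit P θ X)) (cokernel.condition _)

lemma freeUnitComplex_shortExact (hθ : Function.Injective θ) (X : Type v) :
    (freeUnitComplex P θ X).ShortExact :=
  ShortComplex.ShortExact.mk' (ShortComplex.exact_of_g_is_cokernel _ (cokernelIsCokernel _))
    ((ModuleCat.mono_iff_injective _).2 (freeUnit_injective hθ X))
    (inferInstanceAs (Epi (cokernel.π (freeUnit P θ X))))

instance (X : Type v) : Projective (freeUnitComplex P θ X).X₁ :=
  ModuleCat.projective_of_free (Finsupp.basisSingleOne (R := R) (ι := X))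

lemma isRightOnePerpTo_cokernel (hθ : Function.Injective θ) (X : Type v)
    (C : ObjectProperty (ModuleCat.{v} R)) (hC : ∀ M, C M ↔ HasUniqueExtensions P θ X M)
    (hExt : ∀ M, C M → Subsingleton (Ext.{v} ((freeObj P θ).obj X) M 1)) :
    IsRightOnePerpTo.{v} C (.singleton (freeUnitComplex P θ X).X₃) := fun M => by
  have hS := freeUnitComplex_shortExact hθ X
  simp only [ObjectProperty.singleton_iff, forall_eq']
  refine ⟨fun hM => subsingleton_ext_of_bijective_comp hS M ?_ (hExt M hM), fun h => ?_⟩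
  · exact (hasUniqueExtensions_iff X M).1 ((hC M).1 hM)
  · exact (hC M).2 ((hasUniqueExtensions_iff X M).2
      (bijective_comp_of_subsingleton_ext hS M h.1 h.2))

lemma subsingleton_ext_freeObj_of_induces [Projective P] {i : ℕ}
    (h : InducesExtIso (homFunctor P θ) (i + 1)) (X : Type v) (M : ModuleCat.{v} R)
    (hM : (homFunctor P θ).essImage M) :
    Subsingleton (Ext.{v} ((freeObj P θ).obj X) M (i + 1)) := by
  obtain ⟨A, ⟨e⟩⟩ := hM
  have hA := subsingleton_ext_obj_of_induces.{v} (homFunctor P θ) h ((copower P).obj X) A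
  refine subsingleton_of_forall_eq 0 fun x => ?_
  have h0 : x.comp (Ext.mk₀ e.inv) (add_zero _) = 0 := hA.elim _ _
  have h1 := congrArg (fun y => Ext.comp y (Ext.mk₀ e.hom) (add_zero _)) h0
  simpa using h1

lemma isRightPerpTo_cokernel [Projective P] (hθ : Function.Injective θ) (X : Type v)
    (hX : ∀ M, (homFunctor P θ).essImage M ↔ HasUniqueExtensions P θ X M)
    (n : ℕ∞) (hn : 1 ≤ n) (h : ∀ i : ℕ, (i : ℕ∞) ≤ n → InducesExtIso (homFunctor P θ) i) :
    IsRightPerpTo.{v} n (homFunctor P θ).essImage (.singleton (freeUnitComplex P θ X).X₃) := by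
  have hS := freeUnitComplex_shortExact hθ X
  have h1 := isRightOnePerpTo_cokernel hθ X _ hX
    (subsingleton_ext_freeObj_of_induces (h 1 (by exact_mod_cast hn)) X)
  refine ⟨h1, fun Y M hY hM i hi => ?_⟩
  match i with
  | 0 => exact (subsingleton_ext_zero_iff.{v} _ _).2 ((h1 M).1 hM Y hY).1
  | 1 => exact ((h1 M).1 hM Y hY).2
  | j + 2 =>
    obtain rfl := (ObjectProperty.singleton_iff _ _).1 hY
    have := subsingleton_ext_freeObj_of_induces (h _ hi) X M hM
    have h2 := Ext.subsingleton_of_projective.{v} (freeUnitComplex P θ X).X₁ M j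
    rw [show j + 2 = 1 + (j + 1) by omega] at this ⊢
    exact subsingleton_ext_of_contravariant hS M (j + 1) h2 this

end Perpendicular

end RightPerp

theorem mainTheorem3 {B : Type u} [Category.{v} B] [Abelian B] [IsLocallyPresentable.{v} B]
    (P : B) [Projective P] (hP : IsSeparator P) {R : Type v} [Ring R]
    (θ : R →+* (End P)ᵐᵒᵖ)
    (hfull : (RightPerp.homFunctor P θ).Full)
    (hfaithful : (RightPerp.homFunctor P θ).Faithful) :
    -- (a)
    (∃ F : MorphismProperty (ModuleCat.{v} R), MorphismProperty.IsSmall.{v} F ∧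
      RightPerp.IsRightZeroPerpTo (RightPerp.homFunctor P θ).essImage F) ∧
    (Function.Injective θ →
      -- (b), for sets and for classes of objects
      ((∃ E : ObjectProperty (ModuleCat.{v} R), ObjectProperty.Small.{v} E ∧
          RightPerp.IsRightOnePerpTo.{v} (RightPerp.homFunctor P θ).essImage E) ↔
        (RightPerp.homFunctor P θ).essImage.IsClosedUnderExtensions) ∧
      ((∃ E : ObjectProperty (ModuleCat.{v} R),
          RightPerp.IsRightOnePerpTo.{v} (RightPerp.homFunctor P θ).essImage E) ↔
        (RightPerp.homFunctor P θ).essImage.IsClosedUnderExtensions) ∧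
      -- (c)
      (∀ n : ℕ, 1 ≤ n → (∀ i : ℕ, i ≤ n → RightPerp.InducesExtIso (RightPerp.homFunctor P θ) i) →
        ∃ E : ObjectProperty (ModuleCat.{v} R), ObjectProperty.Small.{v} E ∧
          RightPerp.IsRightPerpTo.{v} n (RightPerp.homFunctor P θ).essImage E) ∧
      -- (d)
      ((∀ i : ℕ, RightPerp.InducesExtIso (RightPerp.homFunctor P θ) i) →
        ∃ E : ObjectProperty (ModuleCat.{v} R), ObjectProperty.Small.{v} E ∧
          RightPerp.IsRightPerpTo.{v} ⊤ (RightPerp.homFunctor P θ).essImage E)) := by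
  obtain ⟨κ, _, _⟩ := IsLocallyPresentable.exists_cardinal.{v} B
  have : HasColimitsOfSize.{v, v} B := IsCardinalLocallyPresentable.toHasColimitsOfSize κ
  have : HasCoproducts.{v} B := fun _ => inferInstance
  have := hfull
  have := hfaithful
  obtain ⟨K, hK⟩ := RightPerp.exists_essImage_iff_hasUniqueExtensions (P := P) (θ := θ)
  refine ⟨⟨.ofHoms fun _ : PUnit.{v + 1} => RightPerp.freeUnit P θ K, inferInstance,
    fun M => ?_⟩, fun hθ => ?_⟩
  · rw [hK, RightPerp.hasUniqueExtensions_iff]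
    refine ⟨fun h _ _ f hf => ?_, fun h => h _ ⟨PUnit.unit⟩⟩
    obtain ⟨_⟩ := hf
    exact h
  · let E : ObjectProperty (ModuleCat.{v} R) := .singleton (RightPerp.freeUnitComplex P θ K).X₃
    have hE : ObjectProperty.Small.{v} E := inferInstance
    have hperp (hC : (RightPerp.homFunctor P θ).essImage.IsClosedUnderExtensions) :
        RightPerp.IsRightOnePerpTo.{v} (RightPerp.homFunctor P θ).essImage E :=
      RightPerp.isRightOnePerpTo_cokernel hθ K _ hK
        (RightPerp.subsingleton_ext_one_homFunctor_obj hC ((RightPerp.copower P).obj K))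
    refine ⟨⟨fun ⟨_, _, h⟩ => h.isClosedUnderExtensions, fun hC => ⟨E, hE, hperp hC⟩⟩,
      ⟨fun ⟨_, h⟩ => h.isClosedUnderExtensions, fun hC => ⟨E, hperp hC⟩⟩,
      fun n hn h => ⟨E, hE, ?_⟩, fun h => ⟨E, hE, ?_⟩⟩
    · exact RightPerp.isRightPerpTo_cokernel hθ K hK n (by exact_mod_cast hn)
        fun i hi => h i (by exact_mod_cast hi)
    · exact RightPerp.isRightPerpTo_cokernel hθ K hK ⊤ le_top fun i _ => h i
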